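/- Let $(a_n)_{n\ge 0}$ be a sequence of non-negative real numbers such that $$1=a_0\ge a_1\ge a_2\ge\cdots,\qquad a_i-2a_{i+1}+a_{i+2}\ge 0\quad(i\ge 0).$$ Let $T$ be the shift on $X=\{0,1\}^{\mathbb N}$. For a finite word $w$ over $\{0,1\}$ let $[w]\subset X$ be the cylinder of sequences beginning with $w$, and for a Borel probability measure $\mu$ on $X$ write $p_w=\mu([w])$. Let $0^n$ be the word consisting of $n$ zeros ($0^0$ being the empty word), and call the words $0^n$, $n\ge 0$, blocks of zeros. Put $h(x)=-x\log x$ for $x>0$ and $h(0)=0$, and let $h_\nu$ denote the Kolmogorov–Sinai entropy of $T$ with respect to a $T$-invariant Borel probability measure $\nu$. Then there exists a $T$-invariant Borel probability measure $\mu$ on $X$ with $\mu([0^n])=a_n$ for all $n\ge 1$ such that: (i) for every word $w$ that is not a block of zeros, $$p_{\varepsilon w\varepsilon'}=\frac{p_{\varepsilon w}\,p_{w\varepsilon'}}{p_w}\qquad(\varepsilon,\varepsilon'\in\{0,1\}),$$ where the right-hand side is read as $0$ if $p_w=0$; and for all $n\ge 0$, $$p_{00^n0}=a_{n+2},\quad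 p_{00^n1}=p_{10^n0}=a_{n+1}-a_{n+2},\quad p_{10^n1}=a_n-2a_{n+1}+a_{n+2};$$ (ii) $\mu$ is the only Borel probability measure on $X$ satisfying all the relations in (i); (iii) $\mu$ is the unique measure of maximal entropy among the $T$-invariant Borel probability measures $\nu$ on $X$ with $\nu([0^n])=a_n$ for all $n\ge 1$: every such $\nu$ satisfies $h_\nu\le h_\mu$, with equality only if $\nu=\mu$; (iv) the series $\sum_{j\ge 0}h(a_j-2a_{j+1}+a_{j+2})$ converges and $$h_\mu=-h(1-a_1)+\sum_{j=0}^{\infty}h(a_j-2a_{j+1}+a_{j+2}).$$ -/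

import Mathlib

open MeasureTheory

noncomputable section

namespace ZeroBlocks

/-- Shannon entropy `H(ξ) = ∑_i -μ(ξ = i) log μ(ξ = i)` (natural logarithm, `0 log 0 = 0`) of the
finite partition of `Ω` into the fibres of `ξ`. -/
def partitionEntropy {Ω ι : Type*} [MeasurableSpace Ω] [Fintype ι] (μ : Measure Ω) (ξ : Ω → ι) :
    ℝ :=
  ∑ i, Real.negMulLog (μ.real (ξ ⁻¹' {i}))

/-- The partition `ξ ∨ T⁻¹ξ ∨ ⋯ ∨ T^{-(n-1)}ξ`, as the map sending a point to its itinerary. -/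
def itinerary {Ω ι : Type*} (T : Ω → Ω) (ξ : Ω → ι) (n : ℕ) (x : Ω) : Fin n → ι :=
  fun i => ξ (T^[(i : ℕ)] x)

/-- Entropy `h_μ(T, ξ) = lim_n (1/n) H(ξ ∨ ⋯ ∨ T^{-(n-1)}ξ)` of `T` relative to a finite partition.
For a `T`-invariant probability measure the limit exists, so the limsup is the limit. -/
def entropyOfPartition {Ω ι : Type*} [MeasurableSpace Ω] [Fintype ι] (T : Ω → Ω)
    (μ : Measure Ω) (ξ : Ω → ι) : EReal :=
  Filter.limsup (fun n : ℕ => ((partitionEntropy μ (itinerary T ξ n) / n : ℝ) : EReal))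
    Filter.atTop

/-- Kolmogorov–Sinai (measure-theoretic) entropy: the supremum of `h_μ(T, ξ)` over all finite
measurable partitions `ξ`. -/
def ksEntropy {Ω : Type*} [MeasurableSpace Ω] (T : Ω → Ω) (μ : Measure Ω) : EReal :=
  ⨆ (k : ℕ) (ξ : Ω → Fin k) (_ : Measurable ξ), entropyOfPartition T μ ξ

/-- The symbolic space `{0,1}^ℕ`, with its product (= Borel) σ-algebra. -/
abbrev Seq : Type := ℕ → Fin 2

/-- The shift transformation. -/
def shift (x : Seq) : Seq := fun n => x (n + 1)

/-- The cylinder `[w]` of sequences beginning with the word `w`. -/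
def cylinder (w : List (Fin 2)) : Set Seq := {x | ∀ i : Fin w.length, x i = w.get i}

/-- The block `0^n` (the empty word for `n = 0`). -/
def zeros (n : ℕ) : List (Fin 2) := List.replicate n 0

/-- Shift-invariant Borel probability measures `ν` on `{0,1}^ℕ` with `ν([0^n]) = a_n`, `n ≥ 1`. -/
def invMeasures (a : ℕ → ℝ) : Set (Measure Seq) :=
  {ν | IsProbabilityMeasure ν ∧ MeasurePreserving shift ν ν ∧
    ∀ n, 1 ≤ n → ν.real (cylinder (zeros n)) = a n}

/-- The values on the blocks `ε 0^n ε'`, `n ≥ 0`. -/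
def ZeroBlockValues (a : ℕ → ℝ) (μ : Measure Seq) : Prop :=
  ∀ n : ℕ,
    μ.real (cylinder (0 :: (zeros n ++ [0]))) = a (n + 2) ∧
    μ.real (cylinder (0 :: (zeros n ++ [1]))) = a (n + 1) - a (n + 2) ∧
    μ.real (cylinder (1 :: (zeros n ++ [0]))) = a (n + 1) - a (n + 2) ∧
    μ.real (cylinder (1 :: (zeros n ++ [1]))) = a n - 2 * a (n + 1) + a (n + 2)

/-- The recursion `p_{εwε'} = p_{εw} p_{wε'} / p_w` for every word `w` that is not a block of
zeros (the empty word is the block `0^0`); the quotient is `0` when `p_w = 0`. -/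
def Recursion (μ : Measure Seq) : Prop :=
  ∀ w : List (Fin 2), (∀ n, w ≠ zeros n) → ∀ ε ε' : Fin 2,
    μ.real (cylinder (ε :: (w ++ [ε']))) =
      μ.real (cylinder (ε :: w)) * μ.real (cylinder (w ++ [ε'])) / μ.real (cylinder w)

end ZeroBlocks

end

/-! ### Mutual information of finite nonnegative matrices -/

namespace ZeroBlocks

open Real Finset

/-! Let H_n be the entropy of the partition into cylinders of length n. For an invariant measure,
2H_{n+1} - H_n - H_{n+2} is the sum, over words w of length n, of the mutual information (weighted
by p_w) of the two letters flanking w (`sum_wordGap`). The term w = 0^n depends only on the sequence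
a; every other term is nonnegative and vanishes exactly when the recursion holds at w
(`wordGap_eq_zero_iff`).

Telescoping (`wordEntropy_sub_eq`) expresses H_{n+1} - H_n, whose limit is the Kolmogorov–Sinai
entropy (`ksEntropy_shift_eq`). Hence h_ν = -h(1 - a_1) + S minus the total defect of ν
(`ksEntropy_eq_sub_tsum`), with S the series in the theorem. Maximality thus means zero defect, that
is, the recursion, and recursion plus block values determine all cylinders by induction on length
(`eq_of_recursion`).

The maximiser is a renewal process: given a 1, the successive gaps of zeros are independent, of
length k with probability (a_k - 2a_{k+1} + a_{k+2})/(1 - a_1) (`exists_recursive_measure`). -/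

lemma mul_log_ratio_ge {x r c P : ℝ} (hx : 0 ≤ x) (hr : x ≤ r) (hc : x ≤ c) (hrP : r ≤ P) :
    x - r * c / P ≤ x * (log x + log P - log r - log c) := by
  rcases hx.eq_or_lt with rfl | hx
  · have : 0 ≤ r * c / P := div_nonneg (mul_nonneg hr hc) (hr.trans hrP)
    linarith
  · have hr' : 0 < r := hx.trans_le hr
    have hc' : 0 < c := hx.trans_le hc
    have hP : 0 < P := hr'.trans_le hrP
    -- This is log t ≤ t - 1 at t = rc/(xP), to be multiplied by x; strictness for t ≠ 1 gives the
    -- equality case in the next lemma.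
    have h := log_le_sub_one_of_pos (show 0 < r * c / (x * P) by positivity)
    rw [log_div (by positivity) (by positivity), log_mul hr'.ne' hc'.ne',
      log_mul hx.ne' hP.ne'] at h
    have h2 := mul_le_mul_of_nonneg_left h hx.le
    have h3 : x * (r * c / (x * P) - 1) = r * c / P - x := by field_simp
    linarith

lemma mul_eq_of_mul_log_ratio_eq {x r c P : ℝ} (hx : 0 ≤ x) (hr : x ≤ r) (hc : x ≤ c) (hrP : r ≤ P)
    (h : x * (log x + log P - log r - log c) = x - r * c / P) : x * P = r * c := by
  rcases hx.eq_or_lt with rfl | hx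
  · have h0 : r * c / P = 0 := by linarith
    rcases div_eq_zero_iff.1 h0 with h0 | h0
    · rw [h0, zero_mul]
    -- Here P = 0 and the quotient is a default value, but r ≤ P forces r = 0.
    · rw [le_antisymm (h0 ▸ hrP) hr]; simp
  · have hr' : 0 < r := hx.trans_le hr
    have hc' : 0 < c := hx.trans_le hc
    have hP : 0 < P := hr'.trans_le hrP
    by_contra hne
    have h1 := log_lt_sub_one_of_pos (show 0 < r * c / (x * P) by positivity)
      (fun h => hne ((div_eq_one_iff_eq (by positivity)).1 h).symm)
    rw [log_div (by positivity) (by positivity), log_mul hr'.ne' hc'.ne',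
      log_mul hx.ne' hP.ne'] at h1
    have h2 := mul_lt_mul_of_pos_left h1 hx
    have h3 : x * (r * c / (x * P) - 1) = r * c / P - x := by field_simp
    linarith

section Matrix

variable {α β : Type*} [Fintype α] [Fintype β]

/-- The mutual information of a (not necessarily normalised) joint distribution. -/
noncomputable def infoGap (p : α → β → ℝ) : ℝ :=
  ∑ i, negMulLog (∑ j, p i j) + ∑ j, negMulLog (∑ i, p i j)
    - ∑ i, ∑ j, negMulLog (p i j) - negMulLog (∑ i, ∑ j, p i j)

/-- The corrections p - rc/P have total zero, so inserting them changes nothing and makes each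
summand nonnegative. -/
lemma infoGap_eq_sum (p : α → β → ℝ) :
    infoGap p = ∑ i, ∑ j, (p i j * (log (p i j) + log (∑ i, ∑ j, p i j)
      - log (∑ j, p i j) - log (∑ i, p i j)) - (p i j - (∑ j, p i j) * (∑ i, p i j)
        / ∑ i, ∑ j, p i j)) := by
  have h1 : ∑ i, ∑ j, (∑ j, p i j) * (∑ i, p i j) / (∑ i, ∑ j, p i j) = ∑ i, ∑ j, p i j := by
    simp_rw [← Finset.sum_div, ← Finset.mul_sum, ← Finset.sum_mul]
    rw [Finset.sum_comm (f := fun j i => p i j), mul_self_div_self]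
  have h2 : ∑ j, negMulLog (∑ i, p i j) = -∑ i, ∑ j, p i j * log (∑ i, p i j) := by
    rw [Finset.sum_comm, ← Finset.sum_neg_distrib]
    simp_rw [← Finset.sum_mul, negMulLog, neg_mul]
  have h3 : ∑ i, negMulLog (∑ j, p i j) = -∑ i, ∑ j, p i j * log (∑ j, p i j) := by
    rw [← Finset.sum_neg_distrib]
    simp_rw [← Finset.sum_mul, negMulLog, neg_mul]
  have h4 : negMulLog (∑ i, ∑ j, p i j) = -∑ i, ∑ j, p i j * log (∑ i, ∑ j, p i j) := by
    simp_rw [← Finset.sum_mul, negMulLog, neg_mul]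
  simp_rw [mul_sub, mul_add, Finset.sum_sub_distrib, Finset.sum_add_distrib]
  rw [infoGap, h1, h2, h3, h4]
  simp only [negMulLog, neg_mul, Finset.sum_neg_distrib]
  ring

lemma infoGap_term_nonneg {p : α → β → ℝ} (hp : ∀ i j, 0 ≤ p i j) (i : α) (j : β) :
    0 ≤ p i j * (log (p i j) + log (∑ i, ∑ j, p i j)
      - log (∑ j, p i j) - log (∑ i, p i j)) - (p i j - (∑ j, p i j) * (∑ i, p i j)
        / ∑ i, ∑ j, p i j) := by
  refine sub_nonneg.2 (mul_log_ratio_ge (hp i j) ?_ ?_ ?_)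
  · exact Finset.single_le_sum (f := fun j => p i j) (fun j _ => hp i j) (mem_univ j)
  · exact Finset.single_le_sum (f := fun i => p i j) (fun i _ => hp i j) (mem_univ i)
  · exact Finset.single_le_sum (f := fun i => ∑ j, p i j)
      (fun i _ => Finset.sum_nonneg fun j _ => hp i j) (mem_univ i)

lemma infoGap_nonneg {p : α → β → ℝ} (hp : ∀ i j, 0 ≤ p i j) : 0 ≤ infoGap p := by
  rw [infoGap_eq_sum]
  exact Finset.sum_nonneg fun i _ => Finset.sum_nonneg fun j _ => infoGap_term_nonneg hp i j

lemma infoGap_eq_zero_iff {p : α → β → ℝ} (hp : ∀ i j, 0 ≤ p i j) :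
    infoGap p = 0 ↔ ∀ i j, p i j * ∑ i, ∑ j, p i j = (∑ j, p i j) * ∑ i, p i j := by
  constructor
  · intro h i j
    rw [infoGap_eq_sum, Finset.sum_eq_zero_iff_of_nonneg (fun i _ => Finset.sum_nonneg
      fun j _ => infoGap_term_nonneg hp i j)] at h
    have h1 := h i (mem_univ i)
    rw [Finset.sum_eq_zero_iff_of_nonneg (fun j _ => infoGap_term_nonneg hp i j)] at h1
    refine mul_eq_of_mul_log_ratio_eq (hp i j) ?_ ?_ ?_ (sub_eq_zero.1 (h1 j (mem_univ j)))
    · exact Finset.single_le_sum (f := fun j => p i j) (fun j _ => hp i j) (mem_univ j)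
    · exact Finset.single_le_sum (f := fun i => p i j) (fun i _ => hp i j) (mem_univ i)
    · exact Finset.single_le_sum (f := fun i => ∑ j, p i j)
        (fun i _ => Finset.sum_nonneg fun j _ => hp i j) (mem_univ i)
  · intro h
    rw [infoGap_eq_sum]
    refine Finset.sum_eq_zero fun i _ => Finset.sum_eq_zero fun j _ => ?_
    have hr : p i j ≤ ∑ j, p i j :=
      Finset.single_le_sum (f := fun j => p i j) (fun j _ => hp i j) (mem_univ j)
    have hc : p i j ≤ ∑ i, p i j :=
      Finset.single_le_sum (f := fun i => p i j) (fun i _ => hp i j) (mem_univ i)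
    have hP : ∑ j, p i j ≤ ∑ i, ∑ j, p i j :=
      Finset.single_le_sum (f := fun i => ∑ j, p i j)
        (fun i _ => Finset.sum_nonneg fun j _ => hp i j) (mem_univ i)
    have h1 := h i j
    rcases (hp i j).eq_or_lt with h0 | h0
    · rw [← h0, zero_mul] at h1
      rw [← h0, ← h1]
      simp
    · have hr' := h0.trans_le hr
      have hc' := h0.trans_le hc
      have hP' := hr'.trans_le hP
      have h2 := congrArg log h1
      rw [log_mul h0.ne' hP'.ne', log_mul hr'.ne' hc'.ne'] at h2
      rw [← h1, mul_div_cancel_right₀ _ hP'.ne', h2]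
      ring

end Matrix

lemma negMulLog_sum_le {α : Type*} (s : Finset α) {p : α → ℝ} (hp : ∀ i, 0 ≤ p i) :
    negMulLog (∑ i ∈ s, p i) ≤ ∑ i ∈ s, negMulLog (p i) := by
  rw [negMulLog, neg_mul, Finset.sum_mul, ← Finset.sum_neg_distrib]
  refine Finset.sum_le_sum fun i hi => ?_
  rw [negMulLog, neg_mul, neg_le_neg_iff]
  rcases (hp i).eq_or_lt with h | h
  · simp [← h]
  · exact mul_le_mul_of_nonneg_left
      (log_le_log h (Finset.single_le_sum (fun i _ => hp i) hi)) h.le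

end ZeroBlocks

namespace ZeroBlocks

open Filter Topology

/-! ### Shannon entropy of finite partitions -/

section PartitionEntropy

variable {Ω ι κ τ : Type*} [MeasurableSpace Ω] [Fintype ι] [Fintype κ] [Fintype τ]
  {μ : Measure Ω}

lemma partitionEntropy_comp_measurePreserving [MeasurableSpace ι] [MeasurableSingletonClass ι]
    {X : Ω → ι} (hX : Measurable X) {T : Ω → Ω} (hT : MeasurePreserving T μ μ) :
    partitionEntropy μ (fun x => X (T x)) = partitionEntropy μ X := by
  refine Finset.sum_congr rfl fun i _ => ?_
  congr 1
  exact hT.measureReal_preimage (hX (measurableSet_singleton i)).nullMeasurableSet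

variable [IsProbabilityMeasure μ]

lemma sum_measureReal_fiber [MeasurableSpace ι] [MeasurableSingletonClass ι] {X : Ω → ι}
    (hX : Measurable X) (s : Set ι) [DecidablePred (· ∈ s)] :
    ∑ i with i ∈ s, μ.real (X ⁻¹' {i}) = μ.real (X ⁻¹' s) := by
  rw [sum_measureReal_preimage_singleton _ fun i _ => hX (measurableSet_singleton i)]
  congr 2
  ext i
  simp

lemma measureReal_eq_sum_inter_fiber [MeasurableSpace ι] [MeasurableSingletonClass ι] {X : Ω → ι}
    (hX : Measurable X) (A : Set Ω) : μ.real A = ∑ i, μ.real (A ∩ X ⁻¹' {i}) := by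
  have h := sum_measureReal_preimage_singleton (μ := μ.restrict A) Finset.univ (f := X)
    fun i _ => hX (measurableSet_singleton i)
  simp only [Finset.coe_univ, Set.preimage_univ, measureReal_restrict_apply MeasurableSet.univ,
    Set.univ_inter] at h
  rw [← h]
  exact Finset.sum_congr rfl fun i _ => by
    rw [measureReal_restrict_apply (hX (measurableSet_singleton i)), Set.inter_comm]

lemma partitionEntropy_comp_le [MeasurableSpace ι] [MeasurableSingletonClass ι] {X : Ω → ι}
    (hX : Measurable X) (f : ι → κ) :
    partitionEntropy μ (fun x => f (X x)) ≤ partitionEntropy μ X := by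
  classical
  have h : ∀ j, μ.real ((fun x => f (X x)) ⁻¹' {j}) = ∑ i with f i = j, μ.real (X ⁻¹' {i}) :=
    fun j => (sum_measureReal_fiber hX (f ⁻¹' {j})).symm
  unfold partitionEntropy
  simp_rw [h]
  refine (Finset.sum_le_sum fun j _ => negMulLog_sum_le _ fun i => measureReal_nonneg).trans_eq ?_
  exact Finset.sum_fiberwise _ _ _

/-- Nonnegativity of the mutual information of X and Y on each fibre of Z, summed over the fibres.
-/
lemma partitionEntropy_strong_subadditivity [MeasurableSpace ι] [MeasurableSingletonClass ι]
    [MeasurableSpace κ] [MeasurableSingletonClass κ]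
    {X : Ω → ι} {Y : Ω → κ} (Z : Ω → τ) (hX : Measurable X) (hY : Measurable Y) :
    partitionEntropy μ (fun x => (X x, Y x, Z x)) + partitionEntropy μ Z ≤
      partitionEntropy μ (fun x => (X x, Z x)) + partitionEntropy μ (fun x => (Y x, Z x)) := by
  classical
  let p : τ → ι → κ → ℝ := fun z i j => μ.real ((fun x => (X x, Y x, Z x)) ⁻¹' {(i, j, z)})
  have hXZ : ∀ i z, μ.real ((fun x => (X x, Z x)) ⁻¹' {(i, z)}) = ∑ j, p z i j := by
    intro i z
    rw [measureReal_eq_sum_inter_fiber hY]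
    exact Finset.sum_congr rfl fun j _ => congrArg _ (by ext x; simp; tauto)
  have hYZ : ∀ j z, μ.real ((fun x => (Y x, Z x)) ⁻¹' {(j, z)}) = ∑ i, p z i j := by
    intro j z
    rw [measureReal_eq_sum_inter_fiber hX]
    exact Finset.sum_congr rfl fun i _ => congrArg _ (by ext x; simp; tauto)
  have hZ' : ∀ z, μ.real (Z ⁻¹' {z}) = ∑ i, ∑ j, p z i j := by
    intro z
    simp_rw [← hXZ]
    rw [measureReal_eq_sum_inter_fiber hX]
    exact Finset.sum_congr rfl fun i _ => congrArg _ (by ext x; simp; tauto)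
  have h := Finset.sum_nonneg fun z (_ : z ∈ Finset.univ) =>
    infoGap_nonneg (p := p z) fun i j => measureReal_nonneg
  simp only [infoGap, Finset.sum_sub_distrib, Finset.sum_add_distrib] at h
  have e1 : partitionEntropy μ (fun x => (X x, Y x, Z x)) =
      ∑ z, ∑ i, ∑ j, Real.negMulLog (p z i j) := by
    simp only [partitionEntropy, Fintype.sum_prod_type]
    simp_rw [Finset.sum_comm (s := (Finset.univ : Finset κ))]
    rw [Finset.sum_comm]
  have e2 : partitionEntropy μ (fun x => (X x, Z x)) =
      ∑ z, ∑ i, Real.negMulLog (∑ j, p z i j) := by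
    simp only [partitionEntropy, Fintype.sum_prod_type, hXZ]
    rw [Finset.sum_comm]
  have e3 : partitionEntropy μ (fun x => (Y x, Z x)) =
      ∑ z, ∑ j, Real.negMulLog (∑ i, p z i j) := by
    simp only [partitionEntropy, Fintype.sum_prod_type, hYZ]
    rw [Finset.sum_comm]
  have e4 : partitionEntropy μ Z = ∑ z, Real.negMulLog (∑ i, ∑ j, p z i j) := by
    simp only [partitionEntropy, hZ']
  linarith

end PartitionEntropy

/-! ### Comparing a partition with a generating one -/

section Generator

lemma measurable_itinerary {Ω ι : Type*} [MeasurableSpace Ω] [MeasurableSpace ι] {T : Ω → Ω}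
    (hT : Measurable T) {ξ : Ω → ι} (hξ : Measurable ξ) (n : ℕ) :
    Measurable (itinerary T ξ n) :=
  measurable_pi_lambda _ fun i => hξ.comp (hT.iterate i)

variable {Ω ι κ : Type*} [MeasurableSpace Ω] [Fintype ι] [Fintype κ] [MeasurableSpace ι]
  [MeasurableSingletonClass ι] [MeasurableSpace κ] [MeasurableSingletonClass κ]
  {μ : Measure Ω} [IsProbabilityMeasure μ] {T : Ω → Ω}

/-- For m < n, ζ ∘ T^m is a function of the η-itinerary of length n + N. Adjoining the coordinates ξ
∘ T^m one at a time therefore costs at most H(ξ | ζ) each, by strong subadditivity. -/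
lemma partitionEntropy_itinerary_le (hT : MeasurePreserving T μ μ) {ξ ζ : Ω → ι} {η : Ω → κ}
    (hξ : Measurable ξ) (hζ : Measurable ζ) (hη : Measurable η) {N : ℕ} (g : (Fin N → κ) → ι)
    (hg : ∀ x, ζ x = g (itinerary T η N x)) (n : ℕ) :
    partitionEntropy μ (itinerary T ξ n) ≤ partitionEntropy μ (itinerary T η (n + N)) +
      n * (partitionEntropy μ (fun x => (ξ x, ζ x)) - partitionEntropy μ ζ) := by
  have hm := measurable_itinerary (ι := ι) hT.measurable hξ
  have hm' := measurable_itinerary (ι := κ) hT.measurable hη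
  have key : ∀ m ≤ n, partitionEntropy μ
      (fun x => (itinerary T ξ m x, itinerary T η (n + N) x)) ≤
      partitionEntropy μ (itinerary T η (n + N)) +
      m * (partitionEntropy μ (fun x => (ξ x, ζ x)) - partitionEntropy μ ζ) := by
    intro m
    induction m with
    | zero =>
      intro _
      simpa using partitionEntropy_comp_le (μ := μ) (hm' (n + N))
        (fun v => ((fun i => i.elim0 : Fin 0 → ι), v)) |>.trans' (le_of_eq (by
          congr 1; ext x : 1; congr 1; ext i; exact i.elim0))
    | succ m ih =>
      intro hmn
      have ih := ih (by omega)
      have hTm := hT.iterate m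
      have ss := partitionEntropy_strong_subadditivity (μ := μ) (ζ ∘ T^[m])
        (hξ.comp hTm.measurable) ((hm m).prodMk (hm' (n + N)))
      have e1 : partitionEntropy μ (fun x => ((ξ ∘ T^[m]) x, (ζ ∘ T^[m]) x)) =
          partitionEntropy μ (fun x => (ξ x, ζ x)) :=
        partitionEntropy_comp_measurePreserving (hξ.prodMk hζ) hTm
      have e2 : partitionEntropy μ (ζ ∘ T^[m]) = partitionEntropy μ ζ :=
        partitionEntropy_comp_measurePreserving hζ hTm
      have e3 : partitionEntropy μ (fun x => ((itinerary T ξ m x, itinerary T η (n + N) x),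
          (ζ ∘ T^[m]) x)) ≤
          partitionEntropy μ (fun x => (itinerary T ξ m x, itinerary T η (n + N) x)) := by
        refine (partitionEntropy_comp_le ((hm m).prodMk (hm' (n + N)))
          (fun v => (v, g fun i => v.2 ⟨m + i, by omega⟩))).trans' (le_of_eq ?_)
        congr 1
        ext x : 1
        simp only [Function.comp_apply, hg, Prod.mk.injEq, true_and]
        congr 1
        ext i
        simp [itinerary, ← Function.iterate_add_apply, add_comm]
      have e4 : partitionEntropy μ
          (fun x => (itinerary T ξ (m + 1) x, itinerary T η (n + N) x)) ≤
          partitionEntropy μ (fun x => ((ξ ∘ T^[m]) x,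
            (itinerary T ξ m x, itinerary T η (n + N) x), (ζ ∘ T^[m]) x)) := by
        refine (partitionEntropy_comp_le ((hξ.comp hTm.measurable).prodMk
          (((hm m).prodMk (hm' (n + N))).prodMk (hζ.comp hTm.measurable)))
          (fun v => ((Fin.snoc v.2.1.1 v.1 : Fin (m + 1) → ι), v.2.1.2))).trans' (le_of_eq ?_)
        congr 1
        ext x : 1
        simp only [Prod.mk.injEq, and_true]
        ext i
        refine Fin.lastCases ?_ (fun i => ?_) i <;> simp [itinerary]
      push_cast
      linarith
  refine (key n le_rfl).trans' ?_
  exact partitionEntropy_comp_le ((hm n).prodMk (hm' (n + N))) Prod.fst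

/-- If ξ and ζ rarely differ, their joint distribution is close to the diagonal matrix of the law of
ζ; uniform continuity of `negMulLog` on [0,1] compares the entropies entry by entry. -/
lemma exists_conditionalEntropy_lt (ι : Type*) [Fintype ι] [MeasurableSpace ι]
    [MeasurableSingletonClass ι] {ε : ℝ} (hε : 0 < ε) :
    ∃ δ > 0, ∀ ξ ζ : Ω → ι, Measurable ξ → Measurable ζ → μ.real {x | ξ x ≠ ζ x} < δ →
      partitionEntropy μ (fun x => (ξ x, ζ x)) - partitionEntropy μ ζ < ε := by
  classical
  set K : ℝ := Fintype.card ι * Fintype.card ι + 1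
  have hK : 0 < K := by positivity
  have huc := isCompact_Icc.uniformContinuousOn_of_continuous
    (Real.continuous_negMulLog.continuousOn (s := Set.Icc (0 : ℝ) 1))
  obtain ⟨δ, hδ, h⟩ := Metric.uniformContinuousOn_iff.1 huc (ε / K) (by positivity)
  refine ⟨δ, hδ, fun ξ ζ hξ hζ hne => ?_⟩
  have hterm : ∀ i j, Real.negMulLog (μ.real ((fun x => (ξ x, ζ x)) ⁻¹' {(i, j)})) -
      (if i = j then Real.negMulLog (μ.real (ζ ⁻¹' {j})) else 0) ≤ ε / K := by
    intro i j
    split_ifs with hij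
    · subst hij
      refine (le_abs_self _).trans (h _ ⟨measureReal_nonneg, measureReal_le_one⟩ _
        ⟨measureReal_nonneg, measureReal_le_one⟩ ?_).le
      rw [dist_comm, Real.dist_eq, abs_of_nonneg (sub_nonneg.2 (measureReal_mono (by
        intro x; simp)))]
      refine hne.trans_le' (sub_le_iff_le_add'.2 ((measureReal_mono ?_).trans
        (measureReal_union_le _ _)))
      intro x hx
      by_cases hx' : ξ x = ζ x
      · left; simp_all
      · right; exact hx'
    · have := h (μ.real ((fun x => (ξ x, ζ x)) ⁻¹' {(i, j)}))
        ⟨measureReal_nonneg, measureReal_le_one⟩ 0 ⟨le_rfl, zero_le_one⟩ (by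
          rw [Real.dist_eq, sub_zero, abs_of_nonneg measureReal_nonneg]
          refine hne.trans_le' (measureReal_mono ?_)
          intro x hx
          simp only [Set.mem_preimage, Set.mem_singleton_iff, Prod.mk.injEq] at hx
          simpa [hx.1, hx.2] using hij)
      rw [Real.dist_eq, Real.negMulLog_zero] at this
      exact (le_abs_self _).trans this.le
  have hsum := Finset.sum_le_sum fun i (_ : i ∈ Finset.univ) =>
    Finset.sum_le_sum fun j (_ : j ∈ Finset.univ) => hterm i j
  simp only [Finset.sum_sub_distrib, Finset.sum_ite_eq, Finset.mem_univ, if_true,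
    Finset.sum_const, Finset.card_univ, nsmul_eq_mul] at hsum
  simp only [partitionEntropy, Fintype.sum_prod_type]
  refine hsum.trans_lt ?_
  rw [← mul_assoc, mul_div_assoc', div_lt_iff₀ hK, mul_comm ε]
  exact mul_lt_mul_of_pos_right (lt_add_one _) hε

/-- Divide the preceding itinerary bound by n: the extra length N is negligible, and H(ξ | ζ) is
arbitrarily small. -/
lemma entropyOfPartition_le_of_approx (hT : MeasurePreserving T μ μ) {ξ : Ω → ι} {η : Ω → κ}
    (hξ : Measurable ξ) (hη : Measurable η) {L : ℝ}
    (hL : Tendsto (fun n : ℕ => partitionEntropy μ (itinerary T η n) / n) atTop (𝓝 L))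
    (happrox : ∀ δ > 0, ∃ N, ∃ g : (Fin N → κ) → ι,
      μ.real {x | ξ x ≠ g (itinerary T η N x)} < δ) :
    entropyOfPartition T μ ξ ≤ L := by
  refine EReal.le_of_forall_lt_iff_le.1 fun z hz => ?_
  have hz : L < z := EReal.coe_lt_coe_iff.1 hz
  obtain ⟨δ, hδ, h⟩ := exists_conditionalEntropy_lt (μ := μ) ι (half_pos (sub_pos.2 hz))
  obtain ⟨N, g, hg⟩ := happrox δ hδ
  have hζ : Measurable fun x => g (itinerary T η N x) :=
    (measurable_of_finite g).comp (measurable_itinerary hT.measurable hη N)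
  have hc := h ξ (fun x => g (itinerary T η N x)) hξ hζ hg
  have hb := partitionEntropy_itinerary_le hT hξ hζ hη g (fun _ => rfl)
  set c := partitionEntropy μ (fun x => (ξ x, g (itinerary T η N x))) -
    partitionEntropy μ (fun x => g (itinerary T η N x))
  have hlim : Tendsto (fun n : ℕ => partitionEntropy μ (itinerary T η (n + N)) / n) atTop
      (𝓝 L) := by
    have h1 : Tendsto (fun n : ℕ => ((n + N : ℕ) : ℝ) / n) atTop (𝓝 1) := by
      have : Tendsto (fun n : ℕ => 1 + (N : ℝ) / n) atTop (𝓝 (1 + 0)) :=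
        tendsto_const_nhds.add (tendsto_const_div_atTop_nhds_zero_nat _)
      rw [add_zero] at this
      refine this.congr' ?_
      filter_upwards [eventually_gt_atTop 0] with n hn
      have : (n : ℝ) ≠ 0 := by positivity
      push_cast
      field_simp
    have h2 := (hL.comp (tendsto_add_atTop_nat N)).mul h1
    rw [mul_one] at h2
    refine h2.congr' ?_
    filter_upwards [eventually_gt_atTop 0] with n hn
    have h3 : ((n + N : ℕ) : ℝ) ≠ 0 := by positivity
    simp only [Function.comp_apply]
    field_simp
  unfold entropyOfPartition
  refine limsup_le_of_le (by isBoundedDefault) ?_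
  filter_upwards [hlim.eventually_lt_const (show L < L + (z - L) / 2 by linarith),
    eventually_gt_atTop 0] with n hn hn0
  rw [EReal.coe_le_coe_iff]
  have hn0' : (0 : ℝ) < n := by positivity
  rw [div_lt_iff₀ hn0'] at hn
  rw [div_le_iff₀ hn0']
  nlinarith [hb n]

end Generator

/-! ### Cylinders and words -/

section Words

lemma mem_cylinder_iff {w : List (Fin 2)} {x : Seq} :
    x ∈ cylinder w ↔ ∀ i (h : i < w.length), x i = w[i] :=
  ⟨fun hx i h => hx ⟨i, h⟩, fun hx i => hx i i.2⟩

lemma cylinder_nil : cylinder [] = Set.univ :=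
  Set.eq_univ_of_forall fun _ => mem_cylinder_iff.2 fun _ h => absurd h (by simp)

lemma cylinder_cons (ε : Fin 2) (w : List (Fin 2)) :
    cylinder (ε :: w) = shift ⁻¹' cylinder w ∩ (fun x => x 0) ⁻¹' {ε} := by
  ext x
  simp only [Set.mem_inter_iff, Set.mem_preimage, mem_cylinder_iff, Set.mem_singleton_iff]
  constructor
  · intro h
    exact ⟨fun i hi => h (i + 1) (by simpa using hi), h 0 (by simp)⟩
  · rintro ⟨h, h0⟩ (_ | i) hi
    · simpa using h0
    · exact h i (by simpa using hi)

lemma cylinder_concat (w : List (Fin 2)) (ε : Fin 2) :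
    cylinder (w ++ [ε]) = cylinder w ∩ (fun x => x w.length) ⁻¹' {ε} := by
  ext x
  simp only [Set.mem_inter_iff, Set.mem_preimage, mem_cylinder_iff, Set.mem_singleton_iff]
  constructor
  · intro h
    refine ⟨fun i hi => ?_, ?_⟩
    · rw [h i (by simp; omega), List.getElem_append_left]
    · rw [h _ (by simp)]; simp
  · rintro ⟨h, h0⟩ i hi
    simp only [List.length_append, List.length_singleton] at hi
    by_cases hi' : i < w.length
    · rw [h i hi', List.getElem_append_left]
    · obtain rfl : i = w.length := by omega
      rw [h0]; simp

lemma measurable_shift : Measurable shift :=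
  measurable_pi_lambda _ fun n => measurable_pi_apply (n + 1)

lemma itinerary_shift (n : ℕ) (x : Seq) :
    itinerary shift (fun x : Seq => x 0) n x = fun i : Fin n => x i := by
  have h : ∀ k (x : Seq) m, (shift^[k] x) m = x (m + k) := by
    intro k
    induction k with
    | zero => simp
    | succ k ih =>
      intro x m
      rw [Function.iterate_succ_apply, ih, shift, add_assoc]
  ext i
  simp [itinerary, h]

lemma measurable_itinerary_shift (n : ℕ) :
    Measurable (itinerary shift (fun x : Seq => x 0) n) :=
  measurable_itinerary measurable_shift (measurable_pi_apply 0) n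

lemma itinerary_preimage_singleton {n : ℕ} (v : Fin n → Fin 2) :
    itinerary shift (fun x : Seq => x 0) n ⁻¹' {v} = cylinder (List.ofFn v) := by
  ext x
  simp only [Set.mem_preimage, itinerary_shift, Set.mem_singleton_iff, mem_cylinder_iff,
    List.getElem_ofFn, List.length_ofFn, funext_iff]
  exact ⟨fun h i hi => h ⟨i, hi⟩, fun h i => h i i.2⟩

lemma measurableSet_cylinder (w : List (Fin 2)) : MeasurableSet (cylinder w) := by
  rw [← List.ofFn_get w, ← itinerary_preimage_singleton]
  exact measurable_itinerary_shift _ (measurableSet_singleton _)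

lemma partitionEntropy_itinerary_eq (μ : Measure Seq) (n : ℕ) :
    partitionEntropy μ (itinerary shift (fun x : Seq => x 0) n) =
      ∑ v : Fin n → Fin 2, Real.negMulLog (μ.real (cylinder (List.ofFn v))) := by
  simp only [partitionEntropy, itinerary_preimage_singleton]

lemma sum_words_cons (f : List (Fin 2) → ℝ) (n : ℕ) :
    ∑ v : Fin (n + 1) → Fin 2, f (List.ofFn v) =
      ∑ v : Fin n → Fin 2, ∑ ε, f (ε :: List.ofFn v) := by
  rw [← (Fin.consEquiv fun _ => Fin 2).sum_comp, Fintype.sum_prod_type_right]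
  simp [Fin.consEquiv, List.ofFn_succ]

lemma sum_words_concat (f : List (Fin 2) → ℝ) (n : ℕ) :
    ∑ v : Fin (n + 1) → Fin 2, f (List.ofFn v) =
      ∑ v : Fin n → Fin 2, ∑ ε, f (List.ofFn v ++ [ε]) := by
  rw [← (Fin.snocEquiv fun _ => Fin 2).sum_comp, Fintype.sum_prod_type_right]
  simp only [Fin.snocEquiv, Equiv.coe_fn_mk, List.ofFn_succ', Fin.snoc_castSucc, Fin.snoc_last,
    List.concat_eq_append]

/-- Allowing every n ≥ N lets finitely many such sets be described at a common length. -/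
lemma exists_preimage_itinerary_of_mem_measurableCylinders {A : Set Seq}
    (hA : A ∈ measurableCylinders fun _ : ℕ => Fin 2) :
    ∃ N, ∀ n ≥ N, ∃ S : Set (Fin n → Fin 2),
      A = itinerary shift (fun x : Seq => x 0) n ⁻¹' S := by
  obtain ⟨s, S, -, rfl⟩ := (mem_measurableCylinders _).1 hA
  obtain ⟨N, hN⟩ := s.exists_nat_subset_range
  refine ⟨N, fun n hn => ⟨{v | (fun i : s =>
    v ⟨i, (Finset.mem_range.1 (hN i.2)).trans_le hn⟩) ∈ S}, ?_⟩⟩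
  ext x
  simp only [MeasureTheory.mem_cylinder, Set.mem_preimage, Set.mem_ofPred_eq, itinerary_shift]
  rfl

end Words

/-! ### Cylinder weights of invariant measures -/

section Measures

variable {μ ν : Measure Seq}

lemma measureReal_cylinder_nil [IsProbabilityMeasure μ] : μ.real (cylinder []) = 1 := by
  simp [cylinder_nil]

lemma measureReal_cylinder_concat [IsProbabilityMeasure μ] (w : List (Fin 2)) :
    ∑ ε, μ.real (cylinder (w ++ [ε])) = μ.real (cylinder w) := by
  rw [measureReal_eq_sum_inter_fiber (measurable_pi_apply (X := fun _ : ℕ => Fin 2) w.length)]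
  simp_rw [cylinder_concat]

lemma measureReal_cylinder_cons [IsProbabilityMeasure μ] (hμ : MeasurePreserving shift μ μ)
    (w : List (Fin 2)) : ∑ ε, μ.real (cylinder (ε :: w)) = μ.real (cylinder w) := by
  rw [← hμ.measureReal_preimage (measurableSet_cylinder w).nullMeasurableSet,
    measureReal_eq_sum_inter_fiber (measurable_pi_apply (X := fun _ : ℕ => Fin 2) 0)]
  simp_rw [cylinder_cons]

lemma measure_ext_of_cylinder [IsProbabilityMeasure μ] [IsProbabilityMeasure ν]
    (h : ∀ w, μ.real (cylinder w) = ν.real (cylinder w)) : μ = ν := by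
  classical
  refine ext_of_generate_finite _ generateFrom_measurableCylinders.symm
    isPiSystem_measurableCylinders (fun A hA => ?_) (by simp)
  obtain ⟨N, hN⟩ := exists_preimage_itinerary_of_mem_measurableCylinders hA
  obtain ⟨S, rfl⟩ := hN N le_rfl
  rw [← measureReal_eq_measureReal_iff, ← sum_measureReal_fiber (measurable_itinerary_shift N),
    ← sum_measureReal_fiber (measurable_itinerary_shift N)]
  simp_rw [itinerary_preimage_singleton, h]

/-- Two probability measures satisfying the recursion with the same block values agree. -/
lemma eq_of_recursion [IsProbabilityMeasure μ] [IsProbabilityMeasure ν] {a : ℕ → ℝ}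
    (hμ : Recursion μ) (hν : Recursion ν) (hμa : ZeroBlockValues a μ) (hνa : ZeroBlockValues a ν) :
    μ = ν := by
  have hlast : ∀ w : List (Fin 2),
      (∀ ε, μ.real (cylinder (w ++ [ε])) = ν.real (cylinder (w ++ [ε]))) → μ.real (cylinder w) = ν.real (cylinder w) := by
    intro w h
    rw [← measureReal_cylinder_concat, ← measureReal_cylinder_concat (μ := ν)]
    exact Finset.sum_congr rfl fun ε _ => h ε
  have htwo : ∀ ε ε' : Fin 2, μ.real (cylinder [ε, ε']) = ν.real (cylinder [ε, ε']) := by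
    intro ε ε'
    obtain ⟨h1, h2, h3, h4⟩ := hμa 0
    obtain ⟨k1, k2, k3, k4⟩ := hνa 0
    simp only [zeros, List.replicate_zero, List.nil_append] at h1 h2 h3 h4 k1 k2 k3 k4
    fin_cases ε <;> fin_cases ε' <;> simp [*]
  refine measure_ext_of_cylinder fun w => ?_
  induction hn : w.length using Nat.strong_induction_on generalizing w with
  | _ n ih =>
    rcases w with _ | ⟨ε, w⟩
    · rw [measureReal_cylinder_nil, measureReal_cylinder_nil]
    · rcases List.eq_nil_or_concat w with rfl | ⟨w, ε', rfl⟩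
      · exact hlast _ fun ε' => htwo ε ε'
      · rw [List.concat_eq_append] at hn ⊢
        simp only [List.length_cons, List.length_append, List.length_nil] at hn
        by_cases hw : ∀ k, w ≠ zeros k
        · rw [hμ w hw, hν w hw, ih _ (by omega) w rfl,
            ih (w.length + 1) (by omega) (ε :: w) (by simp),
            ih (w.length + 1) (by omega) (w ++ [ε']) (by simp)]
        · push Not at hw
          obtain ⟨k, rfl⟩ := hw
          obtain ⟨h1, h2, h3, h4⟩ := hμa k
          obtain ⟨k1, k2, k3, k4⟩ := hνa k
          fin_cases ε <;> fin_cases ε' <;> simp [*]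

lemma measureReal_cylinder_zeros {a : ℕ → ℝ} (ha0 : a 0 = 1) (hμ : μ ∈ invMeasures a) (n : ℕ) :
    μ.real (cylinder (zeros n)) = a n := by
  obtain ⟨hp, -, h⟩ := hμ
  rcases n with _ | n
  · rw [ha0]; exact measureReal_cylinder_nil
  · exact h _ (by omega)

lemma measureReal_cylinder_zeros_concat_one {a : ℕ → ℝ} (ha0 : a 0 = 1) (hμ : μ ∈ invMeasures a)
    (n : ℕ) : μ.real (cylinder (zeros n ++ [1])) = a n - a (n + 1) := by
  have := hμ.1
  have h := measureReal_cylinder_concat (μ := μ) (zeros n)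
  rw [Fin.sum_univ_two, measureReal_cylinder_zeros ha0 hμ, zeros, ← List.replicate_succ',
    ← zeros, measureReal_cylinder_zeros ha0 hμ] at h
  rw [zeros]
  linarith

lemma measureReal_cylinder_one_cons_zeros {a : ℕ → ℝ} (ha0 : a 0 = 1) (hμ : μ ∈ invMeasures a)
    (n : ℕ) : μ.real (cylinder (1 :: zeros n)) = a n - a (n + 1) := by
  have := hμ.1
  have h := measureReal_cylinder_cons hμ.2.1 (zeros n)
  rw [Fin.sum_univ_two, measureReal_cylinder_zeros ha0 hμ, zeros, ← List.replicate_succ,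
    ← zeros, measureReal_cylinder_zeros ha0 hμ] at h
  rw [zeros]
  linarith

lemma zeros_concat_zero (n : ℕ) : zeros n ++ [0] = zeros (n + 1) := by
  rw [zeros, zeros, List.replicate_succ']

lemma zero_cons_zeros (n : ℕ) : 0 :: zeros n = zeros (n + 1) := by
  rw [zeros, zeros, List.replicate_succ]

/-- Additivity on the right and, by invariance, on the left turns the weights of 0^n into first and
then second differences. -/
lemma zeroBlockValues_of_mem_invMeasures {a : ℕ → ℝ} (ha0 : a 0 = 1) (hμ : μ ∈ invMeasures a) :
    ZeroBlockValues a μ := by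
  intro n
  have := hμ.1
  have h01 : μ.real (cylinder (0 :: (zeros n ++ [1]))) = a (n + 1) - a (n + 2) := by
    rw [← List.cons_append, zero_cons_zeros, measureReal_cylinder_zeros_concat_one ha0 hμ]
  refine ⟨?_, h01, ?_, ?_⟩
  · rw [zeros_concat_zero, zero_cons_zeros, measureReal_cylinder_zeros ha0 hμ]
  · rw [zeros_concat_zero, measureReal_cylinder_one_cons_zeros ha0 hμ]
  · have h := measureReal_cylinder_cons hμ.2.1 (zeros n ++ [1])
    rw [Fin.sum_univ_two, measureReal_cylinder_zeros_concat_one ha0 hμ, h01] at h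
    linarith

end Measures

/-! ### Second differences of word entropy and the entropy of the shift -/

section Entropy

/-- The conditional mutual information, weighted by `p_w`, of the letters surrounding `w`. -/
noncomputable def wordGap (μ : Measure Seq) (w : List (Fin 2)) : ℝ :=
  infoGap fun ε ε' : Fin 2 => μ.real (cylinder (ε :: (w ++ [ε'])))

/-- The entropy of the partition into cylinders of length `n`. -/
noncomputable def wordEntropy (μ : Measure Seq) (n : ℕ) : ℝ :=
  partitionEntropy μ (itinerary shift (fun x : Seq => x 0) n)

/-- The total loss of entropy coming from words of length `n` other than `0^n`. -/
noncomputable def entropyDefect (μ : Measure Seq) (n : ℕ) : ℝ :=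
  ∑ v : Fin n → Fin 2 with v ≠ 0, wordGap μ (List.ofFn v)

variable {μ : Measure Seq}

lemma wordGap_nonneg (w : List (Fin 2)) : 0 ≤ wordGap μ w :=
  infoGap_nonneg fun _ _ => measureReal_nonneg

lemma entropyDefect_nonneg (n : ℕ) : 0 ≤ entropyDefect μ n :=
  Finset.sum_nonneg fun _ _ => wordGap_nonneg _

lemma ofFn_zero (n : ℕ) : List.ofFn (0 : Fin n → Fin 2) = zeros n := by
  rw [zeros, ← List.ofFn_const]; rfl

lemma sum_wordGap_eq_add_entropyDefect (n : ℕ) :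
    ∑ v : Fin n → Fin 2, wordGap μ (List.ofFn v) =
      wordGap μ (zeros n) + entropyDefect μ n := by
  rw [entropyDefect, Finset.filter_ne', ← ofFn_zero]
  exact (Finset.add_sum_erase _ (fun v => wordGap μ (List.ofFn v)) (Finset.mem_univ _)).symm

variable [IsProbabilityMeasure μ]

lemma sum_sum_cylinder (hμ : MeasurePreserving shift μ μ) (w : List (Fin 2)) :
    ∑ ε : Fin 2, ∑ ε' : Fin 2, μ.real (cylinder (ε :: (w ++ [ε']))) = μ.real (cylinder w) := by
  simp_rw [← List.cons_append, measureReal_cylinder_concat]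
  exact measureReal_cylinder_cons hμ w

lemma wordGap_eq (hμ : MeasurePreserving shift μ μ) (w : List (Fin 2)) :
    wordGap μ w = ∑ ε, Real.negMulLog (μ.real (cylinder (ε :: w))) +
      ∑ ε, Real.negMulLog (μ.real (cylinder (w ++ [ε]))) -
      ∑ ε, ∑ ε', Real.negMulLog (μ.real (cylinder (ε :: (w ++ [ε'])))) -
      Real.negMulLog (μ.real (cylinder w)) := by
  rw [wordGap, infoGap, sum_sum_cylinder hμ]
  simp_rw [measureReal_cylinder_cons hμ, ← List.cons_append, measureReal_cylinder_concat]

/-- Vanishing means that the 2 × 2 matrix of flanking letters has product form. If p_w = 0, all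
extensions of w are null too, so the quotient's default value 0 is correct. -/
lemma wordGap_eq_zero_iff (hμ : MeasurePreserving shift μ μ) (w : List (Fin 2)) :
    wordGap μ w = 0 ↔ ∀ ε ε' : Fin 2, μ.real (cylinder (ε :: (w ++ [ε']))) =
      μ.real (cylinder (ε :: w)) * μ.real (cylinder (w ++ [ε'])) / μ.real (cylinder w) := by
  rw [wordGap, infoGap_eq_zero_iff fun _ _ => measureReal_nonneg, sum_sum_cylinder hμ]
  refine forall₂_congr fun ε ε' => ?_
  have h1 : ∑ ε', μ.real (cylinder (ε :: (w ++ [ε']))) = μ.real (cylinder (ε :: w)) := by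
    simp_rw [← List.cons_append, measureReal_cylinder_concat]
  rw [h1, measureReal_cylinder_cons hμ]
  rcases (measureReal_nonneg (μ := μ) (s := cylinder w)).eq_or_lt with h | h
  · have h2 : ∀ ε, μ.real (cylinder (w ++ [ε])) = 0 := by
      have := measureReal_cylinder_concat (μ := μ) w
      rw [← h, Finset.sum_eq_zero_iff_of_nonneg fun _ _ => measureReal_nonneg] at this
      exact fun ε => this ε (Finset.mem_univ _)
    have h3 : μ.real (cylinder (ε :: (w ++ [ε']))) = 0 := by
      have := measureReal_cylinder_cons hμ (w ++ [ε'])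
      rw [h2, Finset.sum_eq_zero_iff_of_nonneg fun _ _ => measureReal_nonneg] at this
      exact this ε (Finset.mem_univ _)
    simp [h2, h3]
  · rw [eq_div_iff h.ne']

lemma sum_wordGap (hμ : MeasurePreserving shift μ μ) (n : ℕ) :
    ∑ v : Fin n → Fin 2, wordGap μ (List.ofFn v) =
      2 * wordEntropy μ (n + 1) - wordEntropy μ (n + 2) - wordEntropy μ n := by
  have h1 := sum_words_cons (fun w => Real.negMulLog (μ.real (cylinder w))) n
  have h2 := sum_words_concat (fun w => Real.negMulLog (μ.real (cylinder w))) n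
  have h3 := sum_words_cons (fun w => Real.negMulLog (μ.real (cylinder w))) (n + 1)
  rw [sum_words_concat (fun w => ∑ ε, Real.negMulLog (μ.real (cylinder (ε :: w))))] at h3
  replace h3 := h3.trans (Finset.sum_congr rfl fun v _ => Finset.sum_comm)
  simp only [wordGap_eq hμ, Finset.sum_sub_distrib, Finset.sum_add_distrib]
  simp only [wordEntropy, partitionEntropy_itinerary_eq]
  linarith

lemma wordEntropy_mono (n : ℕ) : wordEntropy μ n ≤ wordEntropy μ (n + 1) := by
  refine (partitionEntropy_comp_le (measurable_itinerary_shift (n + 1))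
    (fun v i => v (Fin.castSucc i))).trans' (le_of_eq ?_)
  congr 1

lemma wordEntropy_zero : wordEntropy μ 0 = 0 := by
  simp [wordEntropy, partitionEntropy_itinerary_eq, measureReal_cylinder_nil]

lemma entropyDefect_eq_zero_iff (hμ : MeasurePreserving shift μ μ) :
    (∀ n, entropyDefect μ n = 0) ↔ Recursion μ := by
  simp only [entropyDefect, Finset.sum_eq_zero_iff_of_nonneg fun _ _ => wordGap_nonneg _,
    Finset.mem_filter_univ, Recursion]
  constructor
  · intro h w hw
    rw [← wordGap_eq_zero_iff hμ]
    have h1 := h w.length w.get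
    rw [List.ofFn_get] at h1
    refine h1 fun h2 => hw w.length ?_
    rw [← ofFn_zero, ← h2, List.ofFn_get]
  · intro h n v hv
    refine (wordGap_eq_zero_iff hμ _).2 (h _ fun k hk => hv ?_)
    have hk' : k = n := by simpa [zeros] using (congrArg List.length hk).symm
    subst hk'
    rw [← ofFn_zero] at hk
    exact List.ofFn_injective hk

/-- The gap at 0^n is a difference of consecutive boundary terms minus h of the second difference,
so only the latter accumulates. The constant comes from H_1 = h(a_1) + h(1 - a_1), since the
boundary term at N = 0 counts h(1 - a_1) twice. -/
lemma wordEntropy_sub_eq {a : ℕ → ℝ} (ha0 : a 0 = 1) (hμ : μ ∈ invMeasures a) (N : ℕ) :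
    wordEntropy μ (N + 1) - wordEntropy μ N = -Real.negMulLog (1 - a 1)
      + (Real.negMulLog (a (N + 1)) - Real.negMulLog (a N)
        + 2 * Real.negMulLog (a N - a (N + 1)))
      + ∑ j ∈ Finset.range N, Real.negMulLog (a j - 2 * a (j + 1) + a (j + 2))
      - ∑ j ∈ Finset.range N, entropyDefect μ j := by
  induction N with
  | zero =>
    have h0 := measureReal_cylinder_zeros ha0 hμ 1
    have h1 := measureReal_cylinder_zeros_concat_one ha0 hμ 0
    simp only [zeros, List.replicate_zero, List.nil_append, List.replicate_one, zero_add, ha0]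
      at h0 h1
    rw [wordEntropy_zero, wordEntropy, partitionEntropy_itinerary_eq, sum_words_cons
      (fun w => Real.negMulLog (μ.real (cylinder w)))]
    simp [h0, h1, ha0]
    ring
  | succ N ih =>
    have h := sum_wordGap hμ.2.1 N
    obtain ⟨-, v2, -, v4⟩ := zeroBlockValues_of_mem_invMeasures ha0 hμ N
    rw [sum_wordGap_eq_add_entropyDefect, wordGap_eq hμ.2.1] at h
    simp only [Fin.sum_univ_two, v2, v4, measureReal_cylinder_zeros ha0 hμ,
      measureReal_cylinder_zeros_concat_one ha0 hμ, zeros_concat_zero, zero_cons_zeros,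
      measureReal_cylinder_one_cons_zeros ha0 hμ] at h
    rw [Finset.sum_range_succ, Finset.sum_range_succ]
    simp only [add_assoc, one_add_one_eq_two] at *
    linarith

lemma wordEntropy_sub_antitone (hμ : MeasurePreserving shift μ μ) :
    Antitone fun n => wordEntropy μ (n + 1) - wordEntropy μ n := by
  refine antitone_nat_of_succ_le fun n => ?_
  have h1 := sum_wordGap hμ n
  have h2 : 0 ≤ ∑ v : Fin n → Fin 2, wordGap μ (List.ofFn v) :=
    Finset.sum_nonneg fun _ _ => wordGap_nonneg _
  simp only [add_assoc, one_add_one_eq_two]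
  linarith

/-- The Kolmogorov–Sinai entropy of the shift is the limit of the conditional word entropies. -/
lemma ksEntropy_shift_eq (hμ : MeasurePreserving shift μ μ) {L : ℝ}
    (hL : Tendsto (fun n => wordEntropy μ (n + 1) - wordEntropy μ n) atTop (𝓝 L)) :
    ksEntropy shift μ = L := by
  have hlim : Tendsto (fun n : ℕ => wordEntropy μ n / n) atTop (𝓝 L) := by
    refine hL.cesaro.congr fun n => ?_
    rw [Finset.sum_range_sub, wordEntropy_zero, sub_zero, div_eq_inv_mul]
  have hη : Measurable fun x : Seq => x 0 := measurable_pi_apply 0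
  refine le_antisymm (iSup_le fun k => iSup₂_le fun ξ hξ => ?_) ?_
  · refine entropyOfPartition_le_of_approx hμ hξ hη hlim fun δ hδ => ?_
    have hdense := Measure.MeasureDense.of_generateFrom_isSetAlgebra_finite (μ := μ)
      isSetAlgebra_measurableCylinders generateFrom_measurableCylinders.symm
    -- There are k errors to sum; the extra 1 keeps the total below δ and covers k = 0.
    have hδ' : 0 < δ / (k + 1) := by positivity
    choose A hA hAδ using fun i => hdense.approx (ξ ⁻¹' {i}) (hξ (measurableSet_singleton i))
      (measure_ne_top _ _) _ hδ'
    choose N hN using fun i => exists_preimage_itinerary_of_mem_measurableCylinders (hA i)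
    have hM : ∀ i, N i ≤ Finset.univ.sup N := fun i => Finset.le_sup (Finset.mem_univ i)
    choose S hS using fun i => hN i _ (hM i)
    classical
    -- The fallback `ξ 0`, taken at the zero sequence, is an element of `Fin k` available without
    -- knowing k > 0.
    refine ⟨Finset.univ.sup N, fun v => if h : ∃ i, v ∈ S i then h.choose else ξ 0, ?_⟩
    -- Off the symmetric differences, the point lies in A_i only for i = ξ x, so the chosen index is
    -- right.
    have hsub : {x | ξ x ≠ (fun v => if h : ∃ i, v ∈ S i then h.choose else ξ 0)
        (itinerary shift (fun x : Seq => x 0) (Finset.univ.sup N) x)} ⊆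
        ⋃ i ∈ (Finset.univ : Finset (Fin k)), symmDiff (ξ ⁻¹' {i}) (A i) := by
      intro x hx
      simp only [Set.mem_ofPred_eq] at hx
      by_contra hx'
      simp only [Finset.mem_univ, Set.iUnion_true, Set.mem_iUnion, Set.mem_symmDiff,
        Set.mem_preimage, Set.mem_singleton_iff, not_exists, hS] at hx'
      have h0 : itinerary shift (fun x : Seq => x 0) (Finset.univ.sup N) x ∈ S (ξ x) := by
        have := hx' (ξ x)
        tauto
      have h1 : ∃ i, itinerary shift (fun x : Seq => x 0) (Finset.univ.sup N) x ∈ S i := ⟨_, h0⟩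
      rw [dif_pos h1] at hx
      have h2 := hx' h1.choose
      have h3 := h1.choose_spec
      tauto
    refine (measureReal_mono hsub (measure_ne_top _ _)).trans_lt
      ((measureReal_biUnion_finset_le _ _).trans_lt ?_)
    have h1 : ∀ i ∈ (Finset.univ : Finset (Fin k)),
        μ.real (symmDiff (ξ ⁻¹' {i}) (A i)) ≤ δ / (k + 1) := fun i _ =>
      ENNReal.toReal_le_of_le_ofReal hδ'.le (hAδ i).le
    refine (Finset.sum_le_sum h1).trans_lt ?_
    rw [Finset.sum_const, Finset.card_univ, Fintype.card_fin, nsmul_eq_mul, mul_div_assoc',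
      div_lt_iff₀ (by positivity)]
    nlinarith
  · refine le_trans (le_of_eq ?_) (le_iSup_of_le 2 (le_iSup₂_of_le (fun x : Seq => x 0) hη le_rfl))
    exact ((continuous_coe_real_ereal.tendsto L).comp hlim).limsup_eq.symm

end Entropy

/-! ### Measures from consistent cylinder weights -/

/-- A consistent family of cylinder weights is realised by a probability measure. -/
lemma exists_measure_of_cylinder_weights {p : List (Fin 2) → ℝ} (hp : ∀ w, 0 ≤ p w)
    (h1 : p [] = 1) (hadd : ∀ w, p (w ++ [0]) + p (w ++ [1]) = p w) :
    ∃ μ : Measure Seq, IsProbabilityMeasure μ ∧ ∀ w, μ.real (cylinder w) = p w := by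
  classical
  -- Words of length n, padded by zeros, carry Dirac masses; the resulting measure is already
  -- correct on cylinders of length at most n.
  let ext : ∀ n, (Fin n → Fin 2) → Seq := fun n v i => if h : i < n then v ⟨i, h⟩ else 0
  let m : ℕ → Measure Seq := fun n =>
    ∑ v : Fin n → Fin 2, ENNReal.ofReal (p (List.ofFn v)) • Measure.dirac (ext n v)
  have hm : ∀ n (w : List (Fin 2)), w.length ≤ n →
      m n (cylinder w) = ENNReal.ofReal (p w) := by
    intro n w hw
    have hmn : ∀ A : Set Seq, MeasurableSet A → m n A =
        ENNReal.ofReal (∑ v : Fin n → Fin 2, if ext n v ∈ A then p (List.ofFn v) else 0) := by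
      intro A hA
      rw [ENNReal.ofReal_sum_of_nonneg fun v _ => by split_ifs <;> simp [hp]]
      simp only [m, Measure.finsetSum_apply, Measure.smul_apply, smul_eq_mul,
        Measure.dirac_apply' _ hA]
      refine Finset.sum_congr rfl fun v _ => ?_
      by_cases h : ext n v ∈ A <;> simp [h]
    rw [hmn _ (measurableSet_cylinder w)]
    congr 1
    obtain ⟨k, hk⟩ := Nat.exists_eq_add_of_le hw
    clear hmn hw
    induction k generalizing w with
    | zero =>
      rw [add_zero] at hk
      subst hk
      have hiff : ∀ v, ext w.length v ∈ cylinder w ↔ v = w.get := fun v =>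
        ⟨fun h => funext fun i => by simpa [ext] using h i, fun h i => by simp [ext, h]⟩
      simp_rw [hiff]
      rw [Finset.sum_ite_eq' Finset.univ w.get fun v => p (List.ofFn v),
        if_pos (Finset.mem_univ _), List.ofFn_get]
    | succ k ih =>
      rw [← hadd w, ← ih (w ++ [0]) (by simp; omega), ← ih (w ++ [1]) (by simp; omega),
        ← Finset.sum_add_distrib]
      refine Finset.sum_congr rfl fun v _ => ?_
      simp only [cylinder_concat, Set.mem_inter_iff, Set.mem_preimage, Set.mem_singleton_iff]
      by_cases hv : ext n v ∈ cylinder w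
      · rcases Fin.exists_fin_two.1 ⟨ext n v w.length, rfl⟩ with h | h <;> simp [hv, h]
      · simp [hv]
  have hprob : ∀ n, IsProbabilityMeasure (m n) := fun n =>
    ⟨by rw [← cylinder_nil, hm n [] (by simp), h1, ENNReal.ofReal_one]⟩
  let P : ℕ → ProbabilityMeasure Seq := fun n => ⟨m n, hprob n⟩
  -- Compactness gives a weak limit along an ultrafilter; cylinders are clopen, so their weights
  -- pass to the limit.
  obtain ⟨μ, hμ⟩ : ∃ μ, Tendsto P (hyperfilter ℕ) (𝓝 μ) := by
    obtain ⟨μ, -, hμ⟩ := isCompact_univ.ultrafilter_le_nhds ((hyperfilter ℕ).map P) (by simp)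
    exact ⟨μ, hμ⟩
  refine ⟨μ, inferInstance, fun w => ?_⟩
  have hclopen : IsClopen (cylinder w) := by
    rw [← List.ofFn_get w, ← itinerary_preimage_singleton]
    refine (isClopen_discrete _).preimage ?_
    simp only [funext (itinerary_shift w.length)]
    fun_prop
  have ht := ProbabilityMeasure.tendsto_measure_of_null_frontier_of_tendsto'
    (μs := P) (L := hyperfilter ℕ) (μ := μ) hμ (E := cylinder w)
    (by rw [hclopen.frontier_eq, measure_empty])
  have ht' : Tendsto (fun n => (P n : Measure Seq) (cylinder w)) (hyperfilter ℕ)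
      (𝓝 (ENNReal.ofReal (p w))) := by
    refine tendsto_const_nhds.congr' ?_
    refine Nat.hyperfilter_le_atTop ?_
    filter_upwards [eventually_ge_atTop w.length] with n hn
    exact (hm n w hn).symm
  rw [Measure.real, tendsto_nhds_unique ht ht', ENNReal.toReal_ofReal (hp w)]

/-! ### The renewal measure -/

section Weights

/-- The weight of the word `1 0^k w`. -/
noncomputable def oneWeight (a : ℕ → ℝ) : List (Fin 2) → ℕ → ℝ
  | [], k => a k - a (k + 1)
  | 0 :: w, k => oneWeight a w (k + 1)
  | 1 :: w, k => (a k - 2 * a (k + 1) + a (k + 2)) / (1 - a 1) * oneWeight a w 0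

/-- The weight of the word `0^k w`. -/
noncomputable def zeroWeight (a : ℕ → ℝ) : List (Fin 2) → ℕ → ℝ
  | [], k => a k
  | 0 :: w, k => zeroWeight a w (k + 1)
  | 1 :: w, k => (a k - a (k + 1)) / (1 - a 1) * oneWeight a w 0

variable {a : ℕ → ℝ}

lemma sub_succ_antitone (hconv : ∀ i, 0 ≤ a i - 2 * a (i + 1) + a (i + 2)) :
    Antitone fun i => a i - a (i + 1) :=
  antitone_nat_of_succ_le fun i => by have := hconv i; simp only [add_assoc]; norm_num; linarith

lemma oneWeight_nonneg (ha0 : a 0 = 1) (hmono : ∀ n, a (n + 1) ≤ a n)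
    (hconv : ∀ i, 0 ≤ a i - 2 * a (i + 1) + a (i + 2)) (w : List (Fin 2)) (k : ℕ) :
    0 ≤ oneWeight a w k := by
  induction w generalizing k with
  | nil => exact sub_nonneg.2 (hmono k)
  | cons ε w ih =>
    fin_cases ε
    · exact ih _
    · exact mul_nonneg (div_nonneg (hconv k) (by have := hmono 0; simp_all)) (ih _)

lemma zeroWeight_nonneg (ha0 : a 0 = 1) (hnonneg : ∀ n, 0 ≤ a n) (hmono : ∀ n, a (n + 1) ≤ a n)
    (hconv : ∀ i, 0 ≤ a i - 2 * a (i + 1) + a (i + 2)) (w : List (Fin 2)) (k : ℕ) :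
    0 ≤ zeroWeight a w k := by
  induction w generalizing k with
  | nil => exact hnonneg k
  | cons ε w ih =>
    fin_cases ε
    · exact ih _
    · exact mul_nonneg (div_nonneg (sub_nonneg.2 (hmono k)) (by have := hmono 0; simp_all))
        (oneWeight_nonneg ha0 hmono hconv _ _)

/-- First differences are nonnegative and decreasing. In the degenerate case a_1 = 1 they all
vanish, which makes division by 1 - a_1 = 0 harmless. -/
lemma sub_succ_eq_zero (ha0 : a 0 = 1) (hmono : ∀ n, a (n + 1) ≤ a n)
    (hconv : ∀ i, 0 ≤ a i - 2 * a (i + 1) + a (i + 2)) (h : 1 - a 1 = 0) (k : ℕ) :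
    a k - a (k + 1) = 0 := by
  have h1 := sub_succ_antitone hconv (Nat.zero_le k)
  have h2 := hmono k
  simp only [ha0, zero_add] at h1
  linarith

lemma oneWeight_concat (ha0 : a 0 = 1) (hmono : ∀ n, a (n + 1) ≤ a n)
    (hconv : ∀ i, 0 ≤ a i - 2 * a (i + 1) + a (i + 2)) (w : List (Fin 2)) (k : ℕ) :
    oneWeight a (w ++ [0]) k + oneWeight a (w ++ [1]) k = oneWeight a w k := by
  induction w generalizing k with
  | nil =>
    simp only [List.nil_append, oneWeight, zero_add, ha0]
    rcases eq_or_ne (1 - a 1) 0 with h | h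
    · have h1 := sub_succ_eq_zero ha0 hmono hconv h k
      have h2 := sub_succ_eq_zero ha0 hmono hconv h (k + 1)
      rw [h]; simp only [mul_zero]; linarith
    · field_simp; ring_nf
  | cons ε w ih =>
    fin_cases ε
    · exact ih _
    · simp only [Fin.mk_one, List.cons_append, oneWeight, ← mul_add, ih]

lemma zeroWeight_concat (ha0 : a 0 = 1) (hmono : ∀ n, a (n + 1) ≤ a n)
    (hconv : ∀ i, 0 ≤ a i - 2 * a (i + 1) + a (i + 2)) (w : List (Fin 2)) (k : ℕ) :
    zeroWeight a (w ++ [0]) k + zeroWeight a (w ++ [1]) k = zeroWeight a w k := by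
  induction w generalizing k with
  | nil =>
    simp only [List.nil_append, zeroWeight, oneWeight, zero_add, ha0]
    rcases eq_or_ne (1 - a 1) 0 with h | h
    · have h1 := sub_succ_eq_zero ha0 hmono hconv h k
      rw [h]; simp only [mul_zero]; linarith
    · field_simp; ring
  | cons ε w ih =>
    fin_cases ε
    · exact ih _
    · simp only [Fin.mk_one, List.cons_append, zeroWeight, ← mul_add,
        oneWeight_concat ha0 hmono hconv]

/-- At k = 0 this is additivity in the first letter, the source of shift invariance; general k is
needed for the induction. -/
lemma zeroWeight_succ_add (w : List (Fin 2)) (k : ℕ) :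
    zeroWeight a w (k + 1) + oneWeight a w k = zeroWeight a w k := by
  induction w generalizing k with
  | nil => simp [zeroWeight, oneWeight]
  | cons ε w ih =>
    fin_cases ε
    · exact ih _
    · simp only [zeroWeight, oneWeight, ← add_mul, ← add_div]
      congr 2
      ring_nf

lemma zeroWeight_one_cons (ha0 : a 0 = 1) (hmono : ∀ n, a (n + 1) ≤ a n)
    (hconv : ∀ i, 0 ≤ a i - 2 * a (i + 1) + a (i + 2)) (w : List (Fin 2)) :
    zeroWeight a (1 :: w) 0 = oneWeight a w 0 := by
  simp only [zeroWeight, zero_add, ha0]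
  rcases eq_or_ne (1 - a 1) 0 with h | h
  · have hz : ∀ k, oneWeight a w k = 0 := by
      induction w with
      | nil => exact sub_succ_eq_zero ha0 hmono hconv h
      | cons ε w ih =>
        intro k
        fin_cases ε
        · exact ih _
        · simp [oneWeight, ih]
    rw [hz, mul_zero]
  · rw [div_self h, one_mul]

lemma zeroWeight_zeros_append (n : ℕ) (w : List (Fin 2)) (k : ℕ) :
    zeroWeight a (zeros n ++ w) k = zeroWeight a w (k + n) := by
  induction n generalizing k with
  | zero => simp [zeros]
  | succ n ih =>
    rw [← zero_cons_zeros, List.cons_append]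
    exact (ih (k + 1)).trans (by congr 1; omega)

lemma oneWeight_zeros_append (n : ℕ) (w : List (Fin 2)) (k : ℕ) :
    oneWeight a (zeros n ++ w) k = oneWeight a w (k + n) := by
  induction n generalizing k with
  | zero => simp [zeros]
  | succ n ih =>
    rw [← zero_cons_zeros, List.cons_append]
    exact (ih (k + 1)).trans (by congr 1; omega)

lemma exists_eq_zeros_append_one_cons {w : List (Fin 2)} (hw : ∀ n, w ≠ zeros n) :
    ∃ n u, w = zeros n ++ 1 :: u := by
  induction w with
  | nil => exact absurd rfl (hw 0)
  | cons ε w ih =>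
    fin_cases ε
    · obtain ⟨n, u, rfl⟩ := ih fun n hn => hw (n + 1) (by rw [hn]; exact zero_cons_zeros n)
      exact ⟨n + 1, u, by rw [← zero_cons_zeros]; rfl⟩
    · exact ⟨0, w, rfl⟩

/-- The measure with prescribed weights of the blocks of zeros that satisfies the recursion. -/
lemma exists_recursive_measure (ha0 : a 0 = 1) (hnonneg : ∀ n, 0 ≤ a n)
    (hmono : ∀ n, a (n + 1) ≤ a n) (hconv : ∀ i, 0 ≤ a i - 2 * a (i + 1) + a (i + 2)) :
    ∃ μ ∈ invMeasures a, Recursion μ := by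
  obtain ⟨μ, hμ, hμw⟩ := exists_measure_of_cylinder_weights (p := fun w => zeroWeight a w 0)
    (fun w => zeroWeight_nonneg ha0 hnonneg hmono hconv w 0) ha0
    (fun w => zeroWeight_concat ha0 hmono hconv w 0)
  have hcons : ∀ w, ∑ ε, μ.real (cylinder (ε :: w)) = μ.real (cylinder w) := by
    intro w
    rw [Fin.sum_univ_two, hμw, hμw, hμw, zeroWeight_one_cons ha0 hmono hconv]
    exact zeroWeight_succ_add w 0
  have hT : MeasurePreserving shift μ μ := by
    refine ⟨measurable_shift, ?_⟩
    have := Measure.isProbabilityMeasure_map (μ := μ) measurable_shift.aemeasurable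
    refine measure_ext_of_cylinder fun w => ?_
    rw [map_measureReal_apply measurable_shift (measurableSet_cylinder w), ← hcons,
      measureReal_eq_sum_inter_fiber (measurable_pi_apply (X := fun _ : ℕ => Fin 2) 0)]
    simp_rw [cylinder_cons]
  refine ⟨μ, ⟨hμ, hT, fun n _ => ?_⟩, fun w hw => ?_⟩
  · have := zeroWeight_zeros_append (a := a) n [] 0
    rw [hμw]
    simpa [zeroWeight] using this
  · rw [← wordGap_eq_zero_iff hT, wordGap,
      infoGap_eq_zero_iff fun _ _ => measureReal_nonneg, sum_sum_cylinder hT]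
    intro ε ε'
    simp_rw [measureReal_cylinder_cons hT, ← List.cons_append, measureReal_cylinder_concat]
    -- Weights factor at the first 1 of w: one factor sees only ε and n, the other only u and ε'.
    -- Hence the cross products agree.
    obtain ⟨n, u, rfl⟩ := exists_eq_zeros_append_one_cons hw
    simp only [hμw]
    fin_cases ε
    · simp only [Fin.zero_eta, List.append_assoc, List.cons_append, zeroWeight,
        zeroWeight_zeros_append]
      ring
    · simp only [Fin.mk_one, List.append_assoc, List.cons_append,
        zeroWeight_one_cons ha0 hmono hconv, oneWeight_zeros_append, zeroWeight_zeros_append]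
      simp only [oneWeight, zeroWeight]
      ring

end Weights

/-! ### Passage to the limit -/

variable {a : ℕ → ℝ}

lemma tendsto_boundary_terms (hnonneg : ∀ n, 0 ≤ a n) (hmono : ∀ n, a (n + 1) ≤ a n) :
    Tendsto (fun n => Real.negMulLog (a (n + 1)) - Real.negMulLog (a n)
      + 2 * Real.negMulLog (a n - a (n + 1))) atTop (𝓝 0) := by
  have h := tendsto_atTop_ciInf (antitone_nat_of_succ_le hmono)
    ⟨0, Set.forall_mem_range.2 hnonneg⟩
  have h' := h.comp (tendsto_add_atTop_nat 1)
  have hc := Real.continuous_negMulLog.tendsto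
  have := (((hc _).comp h').sub ((hc _).comp h)).add
    (((hc _).comp (h.sub h')).const_mul 2)
  simpa using this

/-- Since H_{n+1} - H_n ≥ 0, the telescoped identity bounds the partial sums of defects. -/
lemma summable_entropyDefect {μ : Measure Seq} (ha0 : a 0 = 1) (hμ : μ ∈ invMeasures a)
    (hnonneg : ∀ n, 0 ≤ a n) (hmono : ∀ n, a (n + 1) ≤ a n) {S : ℝ}
    (hS : HasSum (fun j => Real.negMulLog (a j - 2 * a (j + 1) + a (j + 2))) S) :
    Summable (entropyDefect μ) := by
  have := hμ.1
  have hlim := ((tendsto_boundary_terms hnonneg hmono).const_add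
    (-Real.negMulLog (1 - a 1))).add hS.tendsto_sum_nat
  obtain ⟨B, hB⟩ := hlim.bddAbove_range
  refine summable_of_sum_range_le entropyDefect_nonneg (c := B) fun n => ?_
  have h1 := hB ⟨n, rfl⟩
  have h2 := wordEntropy_sub_eq ha0 hμ n
  have h3 := wordEntropy_mono (μ := μ) n
  simp only at h1
  linarith

lemma ksEntropy_eq_sub_tsum {μ : Measure Seq} (ha0 : a 0 = 1) (hμ : μ ∈ invMeasures a)
    (hnonneg : ∀ n, 0 ≤ a n) (hmono : ∀ n, a (n + 1) ≤ a n) {S : ℝ}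
    (hS : HasSum (fun j => Real.negMulLog (a j - 2 * a (j + 1) + a (j + 2))) S) :
    ksEntropy shift μ =
      ((-Real.negMulLog (1 - a 1) + S - ∑' n, entropyDefect μ n : ℝ) : EReal) := by
  have := hμ.1
  refine ksEntropy_shift_eq hμ.2.1 ?_
  have h := (((tendsto_boundary_terms hnonneg hmono).const_add
    (-Real.negMulLog (1 - a 1))).add hS.tendsto_sum_nat).sub
    (summable_entropyDefect ha0 hμ hnonneg hmono hS).hasSum.tendsto_sum_nat
  rw [add_zero] at h
  exact h.congr fun n => (wordEntropy_sub_eq ha0 hμ n).symm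

lemma second_difference_le_one (ha0 : a 0 = 1) (hnonneg : ∀ n, 0 ≤ a n)
    (hmono : ∀ n, a (n + 1) ≤ a n) (j : ℕ) : a j - 2 * a (j + 1) + a (j + 2) ≤ 1 := by
  have h1 := antitone_nat_of_succ_le hmono (Nat.zero_le j)
  have h2 := hmono (j + 1)
  have h3 := hnonneg (j + 1)
  rw [ha0] at h1
  simp only [add_assoc, one_add_one_eq_two] at h2
  linarith

/-- For a recursive measure the defects vanish, and H_{n+1} - H_n ≤ H_1 - H_0 bounds the partial
sums of the series. -/
lemma summable_negMulLog_second_difference {μ : Measure Seq} (ha0 : a 0 = 1)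
    (hμ : μ ∈ invMeasures a) (hrec : Recursion μ) (hnonneg : ∀ n, 0 ≤ a n)
    (hmono : ∀ n, a (n + 1) ≤ a n) (hconv : ∀ i, 0 ≤ a i - 2 * a (i + 1) + a (i + 2)) :
    Summable fun j => Real.negMulLog (a j - 2 * a (j + 1) + a (j + 2)) := by
  have := hμ.1
  obtain ⟨B, hB⟩ := (tendsto_boundary_terms hnonneg hmono).bddBelow_range
  refine summable_of_sum_range_le (fun j => Real.negMulLog_nonneg (hconv j)
    (second_difference_le_one ha0 hnonneg hmono j))
    (c := wordEntropy μ 1 - wordEntropy μ 0 + Real.negMulLog (1 - a 1) - B) fun n => ?_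
  have h1 := hB ⟨n, rfl⟩
  have h2 := wordEntropy_sub_eq ha0 hμ n
  have h3 := wordEntropy_sub_antitone hμ.2.1 (Nat.zero_le n)
  rw [Finset.sum_eq_zero fun j _ => (entropyDefect_eq_zero_iff hμ.2.1).2 hrec j] at h2
  simp only [zero_add] at h1 h3
  linarith

end ZeroBlocks

theorem mainTheorem8 (a : ℕ → ℝ) (ha0 : a 0 = 1) (hnonneg : ∀ n, 0 ≤ a n)
    (hmono : ∀ n, a (n + 1) ≤ a n)
    (hconv : ∀ i, 0 ≤ a i - 2 * a (i + 1) + a (i + 2)) :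
    ∃ μ : Measure ZeroBlocks.Seq,
      μ ∈ ZeroBlocks.invMeasures a ∧
      ZeroBlocks.Recursion μ ∧
      ZeroBlocks.ZeroBlockValues a μ ∧
      (∀ ν : Measure ZeroBlocks.Seq, IsProbabilityMeasure ν →
        ZeroBlocks.Recursion ν → ZeroBlocks.ZeroBlockValues a ν → ν = μ) ∧
      (∀ ν ∈ ZeroBlocks.invMeasures a,
        ZeroBlocks.ksEntropy ZeroBlocks.shift ν ≤ ZeroBlocks.ksEntropy ZeroBlocks.shift μ) ∧
      (∀ ν ∈ ZeroBlocks.invMeasures a,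
        ZeroBlocks.ksEntropy ZeroBlocks.shift ν = ZeroBlocks.ksEntropy ZeroBlocks.shift μ →
          ν = μ) ∧
      ∃ S : ℝ,
        HasSum (fun j : ℕ => Real.negMulLog (a j - 2 * a (j + 1) + a (j + 2))) S ∧
        ZeroBlocks.ksEntropy ZeroBlocks.shift μ =
          ((-Real.negMulLog (1 - a 1) + S : ℝ) : EReal) := by
  open ZeroBlocks in
  obtain ⟨μ, hμ, hrec⟩ := exists_recursive_measure ha0 hnonneg hmono hconv
  have hval := zeroBlockValues_of_mem_invMeasures ha0 hμ
  have := hμ.1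
  obtain ⟨S, hS⟩ := summable_negMulLog_second_difference ha0 hμ hrec hnonneg hmono hconv
  have hent : ksEntropy shift μ = ((-Real.negMulLog (1 - a 1) + S : ℝ) : EReal) := by
    rw [ksEntropy_eq_sub_tsum ha0 hμ hnonneg hmono hS,
      funext ((entropyDefect_eq_zero_iff hμ.2.1).2 hrec), tsum_zero, sub_zero]
  refine ⟨μ, hμ, hrec, hval, fun ν hν hνrec hνval => eq_of_recursion hνrec hrec hνval hval,
    fun ν hν => ?_, fun ν hν h => ?_, S, hS, hent⟩
  · rw [hent, ksEntropy_eq_sub_tsum ha0 hν hnonneg hmono hS, EReal.coe_le_coe_iff]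
    have h := tsum_nonneg (L := .unconditional ℕ) fun n => entropyDefect_nonneg (μ := ν) n
    linarith
  · have := hν.1
    rw [hent, ksEntropy_eq_sub_tsum ha0 hν hnonneg hmono hS, EReal.coe_eq_coe_iff] at h
    -- Equal entropies force the total defect of ν to be zero, hence every defect, hence the
    -- recursion.
    have h0 : HasSum (entropyDefect ν) 0 := by
      have h1 := (summable_entropyDefect ha0 hν hnonneg hmono hS).hasSum
      rwa [show ∑' n, entropyDefect ν n = 0 by linarith] at h1
    rw [hasSum_zero_iff_of_nonneg entropyDefect_nonneg] at h0
    exact eq_of_recursion ((entropyDefect_eq_zero_iff hν.2.1).1 fun n => congrFun h0 n) hrec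
      (zeroBlockValues_of_mem_invMeasures ha0 hν) hval
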